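/- Let $\mathcal S$ be the class of functions $f$ that are analytic and univalent (injective) in the open unit disc $\mathbb D=\{z\in\mathbb C:|z|<1\}$ and have there the expansion $f(z)=z+a_2z^2+a_3z^3+\cdots$. For $f\in\mathcal S$ put $$H_2(2)=a_2a_4-a_3^2,\qquad H_3(1)=a_3(a_2a_4-a_3^2)-a_4(a_4-a_2a_3)+a_5(a_3-a_2^2).$$ **Theorem.** Let $f\in\mathcal S$ with $a_2=0$. Then (i) $|a_3|\le 1$; (ii) $|a_4|\le \frac23$; (iii) $|a_5|\le \sqrt{\frac{19}{15}}$ (in particular $|a_5|\le\frac{503}{300}=1.67666\ldots$); (iv) $|H_2(2)|\le 1$; (v) $|H_3(1)|\le \frac{21}{20}$. -/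

import Mathlib

/-- The class `𝒮` of functions that are analytic and univalent in the open unit disc
and have an expansion `f z = z + a₂ z² + a₃ z³ + ⋯` there. Values of `f` off the disc are irrelevant. -/
structure SchlichtClass (f : ℂ → ℂ) : Prop where
  analytic : AnalyticOnNhd ℂ f (Metric.ball 0 1)
  univalent : Set.InjOn f (Metric.ball 0 1)
  map_zero : f 0 = 0
  deriv_zero : deriv f 0 = 1

/-- The Taylor coefficient `aₙ` of `f` at the origin. -/
noncomputable def taylorCoeff (f : ℂ → ℂ) (n : ℕ) : ℂ :=
  iteratedDeriv n f 0 / (n.factorial : ℂ)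

/-- For `f` analytic in the unit disc, the numbers `taylorCoeff f n` are the coefficients
of the power series of `f` in the disc. -/
theorem hasSum_taylorCoeff {f : ℂ → ℂ} (hf : AnalyticOnNhd ℂ f (Metric.ball 0 1)) {z : ℂ}
    (hz : z ∈ Metric.ball (0 : ℂ) 1) : HasSum (fun n : ℕ => taylorCoeff f n * z ^ n) (f z) := by
  have h := Complex.hasSum_taylorSeries_on_ball (f := f) (c := 0) (r := 1)
    hf.differentiableOn hz
  refine h.congr_fun ?_
  intro n
  simp only [taylorCoeff, sub_zero, smul_eq_mul]
  ring

/-- The second Hankel determinant `H₂(2) = a₂ a₄ - a₃²` of `f`. -/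
noncomputable def hankelTwoTwo (f : ℂ → ℂ) : ℂ :=
  taylorCoeff f 2 * taylorCoeff f 4 - taylorCoeff f 3 ^ 2

/-- The third Hankel determinant
`H₃(1) = a₃ (a₂ a₄ - a₃²) - a₄ (a₄ - a₂ a₃) + a₅ (a₃ - a₂²)` of `f`. -/
noncomputable def hankelThreeOne (f : ℂ → ℂ) : ℂ :=
  taylorCoeff f 3 * (taylorCoeff f 2 * taylorCoeff f 4 - taylorCoeff f 3 ^ 2)
    - taylorCoeff f 4 * (taylorCoeff f 4 - taylorCoeff f 2 * taylorCoeff f 3)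
    + taylorCoeff f 5 * (taylorCoeff f 3 - taylorCoeff f 2 ^ 2)

/-! Write `1 / f = u / z` with `u = 1 + u₂ z² + u₃ z³ + ⋯`; there is no linear term because `a₂ =
0`. Then `u₂ = -a₃`, `u₃ = -a₄`, `u₄ = -(a₅ - a₃²)`, and two area inequalities suffice. Gronwall's
area theorem (`SchlichtClass.area_bound`) gives `|u₂|² + 2|u₃|² + 3|u₄|² ≤ 1`. It implies everything
except the bound on `a₄`, since `H₂(2) = -a₃²` and `H₃(1) = a₃ (a₅ - a₃²) - a₄²`. For `a₄`, Lebesgue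
measure is replaced by a multiple of `|w| dA(w)` on the set omitted by `1 / f`
(`SchlichtClass.weighted_area_bound`). The natural series is then `q = u^(3/2)`, whose cubic
coefficient is `-(3/2) a₄`, and the inequality gives `|(3/2) a₄| ≤ 1`. Both are instances of
`weighted_coeff_bound`. For a field `V` with `Re ∂V/∂z̄ ≥ 0`, Stokes' formula is applied to `χ V`,
where `χ` is a smooth cutoff equal to 1 on the omitted set (`re_setIntegral_vectorField_nonpos`).
Smearing the boundary circle over an annulus in this way avoids contour integrals and boundary
regularity. Orthogonality of powers (`hasSum_radial_parseval`) turns the result into a coefficient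
inequality. -/

/-! ### Taylor coefficients of products and derivatives. -/

theorem taylorCoeff_mul {F G : ℂ → ℂ} (hF : AnalyticAt ℂ F 0) (hG : AnalyticAt ℂ G 0) (n : ℕ) :
    taylorCoeff (fun z => F z * G z) n =
      ∑ i ∈ Finset.range (n + 1), taylorCoeff F i * taylorCoeff G (n - i) := by
  have h := iteratedDerivWithin_mul (n := n) (Set.mem_univ (0 : ℂ)) uniqueDiffOn_univ
    hF.contDiffAt.contDiffWithinAt hG.contDiffAt.contDiffWithinAt
  simp only [iteratedDerivWithin_univ] at h
  change iteratedDeriv n (F * G) 0 / _ = _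
  rw [h, Finset.sum_div]
  refine Finset.sum_congr rfl fun i hi => ?_
  have hi' : i ≤ n := Nat.lt_succ_iff.mp (Finset.mem_range.mp hi)
  have hc : ((n.choose i : ℕ) : ℂ) * (i.factorial : ℂ) * ((n - i).factorial : ℂ) = n.factorial := by
    exact_mod_cast Nat.choose_mul_factorial_mul_factorial hi'
  have h1 : (i.factorial : ℂ) ≠ 0 := by exact_mod_cast i.factorial_ne_zero
  have h2 : ((n - i).factorial : ℂ) ≠ 0 := by exact_mod_cast (n - i).factorial_ne_zero
  have h3 : (n.factorial : ℂ) ≠ 0 := by exact_mod_cast n.factorial_ne_zero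
  simp only [taylorCoeff]
  field_simp
  rw [← hc]
  ring

theorem taylorCoeff_congr {F G : ℂ → ℂ} (h : F =ᶠ[nhds 0] G) (n : ℕ) :
    taylorCoeff F n = taylorCoeff G n := by
  simp only [taylorCoeff, h.iteratedDeriv_eq]

theorem taylorCoeff_zero (F : ℂ → ℂ) : taylorCoeff F 0 = F 0 := by
  simp [taylorCoeff]

theorem taylorCoeff_one (F : ℂ → ℂ) : taylorCoeff F 1 = deriv F 0 := by
  simp [taylorCoeff, iteratedDeriv_one]

theorem taylorCoeff_id (n : ℕ) : taylorCoeff (fun z => z) n = if n = 1 then 1 else 0 := by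
  rcases n with _ | _ | n
  · simp [taylorCoeff]
  · simp [taylorCoeff, iteratedDeriv_one]
  · rw [taylorCoeff, iteratedDeriv_succ', iteratedDeriv_succ']
    simp

theorem taylorCoeff_id_mul_succ {F : ℂ → ℂ} (hF : AnalyticAt ℂ F 0) (n : ℕ) :
    taylorCoeff (fun z => z * F z) (n + 1) = taylorCoeff F n := by
  rw [taylorCoeff_mul (F := fun z => z) analyticAt_id hF, Finset.sum_eq_single 1]
  · simp [taylorCoeff_id]
  · intro i _ hi
    rw [taylorCoeff_id, if_neg hi, zero_mul]
  · simp

theorem taylorCoeff_deriv (F : ℂ → ℂ) (n : ℕ) :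
    taylorCoeff (deriv F) n = (n + 1) * taylorCoeff F (n + 1) := by
  have h : (n.factorial : ℂ) ≠ 0 := by exact_mod_cast n.factorial_ne_zero
  have h' : (n + 1 : ℂ) ≠ 0 := by exact_mod_cast n.succ_ne_zero
  simp only [taylorCoeff, iteratedDeriv_succ', Nat.factorial_succ]
  push_cast
  field_simp

/-- The Taylor coefficients of `α z F' - F`. -/
theorem taylorCoeff_euler {F : ℂ → ℂ} (hF : AnalyticAt ℂ F 0) (α : ℂ) (n : ℕ) :
    taylorCoeff (fun z => α * (z * deriv F z) - F z) n = (α * n - 1) * taylorCoeff F n := by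
  have hd : AnalyticAt ℂ (fun z => z * deriv F z) 0 := analyticAt_id.mul hF.deriv
  have h1 : taylorCoeff (fun z => z * deriv F z) n = n * taylorCoeff F n := by
    rcases n with _ | n
    · simp [taylorCoeff_zero]
    · rw [taylorCoeff_id_mul_succ hF.deriv, taylorCoeff_deriv]; push_cast; ring
  have h2 : taylorCoeff (fun z => α * (z * deriv F z) - F z) n =
      α * taylorCoeff (fun z => z * deriv F z) n - taylorCoeff F n := by
    simp only [taylorCoeff]
    rw [iteratedDeriv_fun_sub (analyticAt_const.fun_mul hd).contDiffAt hF.contDiffAt,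
      iteratedDeriv_const_mul_field]
    ring
  rw [h2, h1]; ring

/-! ### Analyticity of the inverse of an injective analytic function. -/

section inverse

open Set Filter Topology

variable {f g : ℂ → ℂ} {U : Set ℂ}

theorem isOpen_image_of_injOn (hU : IsOpen U) (hc : IsPreconnected U) (hf : AnalyticOnNhd ℂ f U)
    (hinj : InjOn f U) {s : Set ℂ} (hs : s ⊆ U) (hso : IsOpen s) : IsOpen (f '' s) := by
  rcases hf.is_constant_or_isOpen hc with ⟨w, hw⟩ | h
  · rcases s.eq_empty_or_nonempty with rfl | ⟨x, hx⟩
    · simp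
    · exfalso
      have : U ⊆ {x} := fun y hy => hinj hy (hs hx) ((hw y hy).trans (hw x (hs hx)).symm)
      have hUx : U = {x} := subset_antisymm this (singleton_subset_iff.2 (hs hx))
      exact not_isOpen_singleton x (hUx ▸ hU)
  · exact h s hs hso

/-- The open mapping theorem makes `g` continuous, and it is differentiable at images of noncritical
points. Critical points are isolated, so their images are removable singularities; `f' ≠ 0` never
has to be proved. -/
theorem analyticOnNhd_leftInverse (hU : IsOpen U) (hc : IsPreconnected U)
    (hf : AnalyticOnNhd ℂ f U) (hg : ∀ z ∈ U, g (f z) = z) : AnalyticOnNhd ℂ g (f '' U) := by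
  have hinj : InjOn f U := fun x hx y hy h => by rw [← hg x hx, ← hg y hy, h]
  have hopen : ∀ s ⊆ U, IsOpen s → IsOpen (f '' s) := fun s hs =>
    isOpen_image_of_injOn hU hc hf hinj hs
  have hcont : ∀ z ∈ U, ContinuousAt g (f z) := by
    intro z hz
    rw [ContinuousAt, hg z hz]
    intro s hs
    obtain ⟨t, hts, hto, hzt⟩ := mem_nhds_iff.1 (inter_mem hs (hU.mem_nhds hz))
    have : f '' t ∈ 𝓝 (f z) :=
      (hopen t (fun x hx => (hts hx).2) hto).mem_nhds (mem_image_of_mem f hzt)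
    rw [mem_map]
    filter_upwards [this]
    rintro _ ⟨x, hx, rfl⟩
    rw [mem_preimage, hg x (hts hx).2]
    exact (hts hx).1
  have hdiff : ∀ z ∈ U, deriv f z ≠ 0 → DifferentiableAt ℂ g (f z) := by
    intro z hz h0
    have hfg : ∀ᶠ w in 𝓝 (f z), f (g w) = w := by
      filter_upwards [(hopen U subset_rfl hU).mem_nhds (mem_image_of_mem f hz)]
      rintro _ ⟨x, hx, rfl⟩
      rw [hg x hx]
    exact (HasDerivAt.of_local_left_inverse (f := f) (f' := deriv f z) (hcont z hz)
      (by rw [hg z hz]; exact (hf z hz).differentiableAt.hasDerivAt) h0 hfg).differentiableAt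
  rintro _ ⟨z, hz, rfl⟩
  apply Complex.analyticAt_of_differentiable_on_punctured_nhds_of_continuousAt _ (hcont z hz)
  -- Otherwise `f'` vanishes near `z`, so `f` is locally constant, against injectivity.
  have hev : ∀ᶠ x in 𝓝[≠] z, deriv f x ≠ 0 := by
    rcases (hf z hz).deriv.eventually_eq_zero_or_eventually_ne_zero with h | h
    · exfalso
      obtain ⟨ε, hε, hb⟩ := Metric.eventually_nhds_iff_ball.1 (h.and (hU.mem_nhds hz))
      have hz' : z + (ε / 2 : ℝ) ∈ Metric.ball z ε := by
        simp [abs_of_pos hε, hε]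
      have hcst := (convex_ball z ε).is_const_of_fderivWithin_eq_zero (𝕜 := ℂ) (f := f)
        (fun x hx => (hf x (hb x hx).2).differentiableAt.differentiableWithinAt)
        (fun x hx => by
          rw [fderivWithin_of_isOpen Metric.isOpen_ball hx]
          ext
          simpa using (hb x hx).1) hz' (Metric.mem_ball_self hε)
      have := hinj (hb _ hz').2 hz hcst
      simp [hε.ne'] at this
    · exact h
  rw [eventually_nhdsWithin_iff] at hev ⊢
  obtain ⟨t, ht, hto, hzt⟩ := mem_nhds_iff.1 (inter_mem hev (hU.mem_nhds hz))
  filter_upwards [(hopen t (fun x hx => (ht hx).2) hto).mem_nhds (mem_image_of_mem f hzt)]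
  rintro _ ⟨x, hx, rfl⟩ hne
  exact hdiff x (ht hx).2 ((ht hx).1 (fun h => hne (by rw [mem_singleton_iff.1 h]; rfl)))

end inverse

/-! ### Stokes' formula with a smooth cutoff. -/

section stokes

open Set Filter Topology MeasureTheory Metric

/-- Twice the Cauchy-Riemann operator `∂/∂z̄`. -/
noncomputable def dbar (F : ℂ → ℂ) (w : ℂ) : ℂ :=
  fderiv ℝ F w 1 + Complex.I * fderiv ℝ F w Complex.I

theorem continuous_dbar {F : ℂ → ℂ} (hF : ContDiff ℝ 1 F) : Continuous (dbar F) := by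
  have h := hF.continuous_fderiv one_ne_zero
  unfold dbar
  fun_prop

theorem hasCompactSupport_dbar {F : ℂ → ℂ} (hc : HasCompactSupport F) :
    HasCompactSupport (dbar F) :=
  (hc.fderiv (𝕜 := ℝ)).mono' fun w hw => by
    by_contra h
    exact hw (by simp [dbar, image_eq_zero_of_notMem_tsupport h])

/-- Integration by parts against the constant 1. -/
theorem integral_fderiv_eq_zero_of_hasCompactSupport {F : ℂ → ℂ} (hF : ContDiff ℝ 1 F)
    (hc : HasCompactSupport F) (v : ℂ) : ∫ w, fderiv ℝ F w v = 0 := by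
  have hcont : Continuous fun w => fderiv ℝ F w v := by
    have h := hF.continuous_fderiv one_ne_zero
    fun_prop
  have hint : Integrable (fun w => fderiv ℝ F w v) :=
    hcont.integrable_of_hasCompactSupport (hc.fderiv_apply ℝ v)
  have := integral_mul_fderiv_eq_neg_fderiv_mul_of_integrable (μ := (volume : Measure ℂ))
    (f := fun _ : ℂ => (1 : ℂ)) (g := F) (v := v) (by simp) (by simpa using hint)
    (by simpa using hF.continuous.integrable_of_hasCompactSupport hc)
    (fun x _ => differentiableAt_const _) (fun x _ => hF.differentiable one_ne_zero x)
  simpa using this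

theorem integral_dbar_eq_zero {F : ℂ → ℂ} (hF : ContDiff ℝ 1 F) (hc : HasCompactSupport F) :
    ∫ w, dbar F w = 0 := by
  have hint : ∀ v, Integrable (fun w => fderiv ℝ F w v) := fun v =>
    Continuous.integrable_of_hasCompactSupport
      (by have h := hF.continuous_fderiv one_ne_zero; fun_prop) (hc.fderiv_apply ℝ v)
  unfold dbar
  rw [integral_add (hint 1) ((hint _).const_mul _), integral_const_mul,
    integral_fderiv_eq_zero_of_hasCompactSupport hF hc,
    integral_fderiv_eq_zero_of_hasCompactSupport hF hc]
  simp

theorem dbar_mul {F G : ℂ → ℂ} {w : ℂ} (hF : DifferentiableAt ℝ F w)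
    (hG : DifferentiableAt ℝ G w) :
    dbar (fun z => F z * G z) w = F w * dbar G w + G w * dbar F w := by
  unfold dbar
  rw [fderiv_fun_mul hF hG]
  simp
  ring

theorem dbar_comp {F h : ℂ → ℂ} {z : ℂ} (hF : DifferentiableAt ℝ F (h z))
    (hh : DifferentiableAt ℂ h z) :
    dbar (fun z => F (h z)) z = (starRingEnd ℂ) (deriv h z) * dbar F (h z) := by
  have hd : HasFDerivAt (fun z => F (h z)) ((fderiv ℝ F (h z)).comp
      ((ContinuousLinearMap.toSpanSingleton ℂ (deriv h z)).restrictScalars ℝ)) z :=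
    hF.hasFDerivAt.comp z (hh.hasDerivAt.hasFDerivAt.restrictScalars ℝ)
  have hlin : ∀ v : ℂ, fderiv ℝ F (h z) v =
      v.re * fderiv ℝ F (h z) 1 + v.im * fderiv ℝ F (h z) Complex.I := by
    intro v
    conv_lhs => rw [show v = v.re • (1 : ℂ) + v.im • Complex.I by
      simp [Complex.re_add_im]]
    rw [map_add, map_smul, map_smul]
    simp
  unfold dbar
  rw [hd.fderiv]
  simp only [ContinuousLinearMap.comp_apply, ContinuousLinearMap.coe_restrictScalars',
    ContinuousLinearMap.toSpanSingleton_apply, smul_eq_mul, one_mul]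
  rw [hlin (deriv h z), hlin (Complex.I * deriv h z)]
  apply Complex.ext <;> simp <;> ring

theorem dbar_radial {ψ : ℝ → ℝ} (hψ : ContDiff ℝ 1 ψ) (z : ℂ) :
    dbar (fun z => (ψ (Complex.normSq z) : ℂ)) z = 2 * (deriv ψ (Complex.normSq z) * z) := by
  have h1 : HasFDerivAt (fun z : ℂ => Complex.normSq z)
      (2 • (z.re • Complex.reCLM + z.im • Complex.imCLM)) z := by
    have hr := Complex.reCLM.hasFDerivAt (x := z)
    have hi := Complex.imCLM.hasFDerivAt (x := z)
    have := (hr.mul hr).add (hi.mul hi)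
    refine (this.congr_fderiv ?_).congr_of_eventuallyEq (.of_forall fun w => by
      simp [Complex.normSq_apply])
    ext
    simp
    ring
  have h2 := ((hψ.differentiable one_ne_zero (Complex.normSq z)).hasDerivAt).comp_hasFDerivAt z h1
  have h3 := Complex.ofRealCLM.hasFDerivAt.comp z h2
  have h4 : fderiv ℝ (fun z => (ψ (Complex.normSq z) : ℂ)) z = _ := h3.fderiv
  unfold dbar
  rw [h4]
  apply Complex.ext <;> simp <;> ring

/-- The radial profile `ψ(|z|²)` is transported to the `w`-plane by `w = 1 / f z`. Since `ψ`
vanishes near `z = 0`, the cutoff vanishes near `w = ∞`; since `ψ = 1` near the unit circle,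
extending by 1 over the omitted set is smooth. -/
theorem exists_cutoff {f : ℂ → ℂ} (hf : AnalyticOnNhd ℂ f (ball 0 1)) (hinj : InjOn f (ball 0 1))
    (h0 : f 0 = 0) {ψ : ℝ → ℝ} (hψ : ContDiff ℝ 1 ψ) (hψ0 : ∀ t, 0 ≤ ψ t) {a b : ℝ} (ha : 0 < a)
    (hb : b < 1) (hψa : ∀ t ≤ a, ψ t = 0) (hψb : ∀ t, b ≤ t → ψ t = 1) :
    ∃ χ : ℂ → ℝ, ContDiff ℝ 1 χ ∧ HasCompactSupport χ ∧ (∀ w, 0 ≤ χ w) ∧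
      (∀ z ∈ ball (0 : ℂ) 1, z ≠ 0 → χ (f z)⁻¹ = ψ (Complex.normSq z)) ∧
      ∀ w ∉ (fun z => (f z)⁻¹) '' (ball (0 : ℂ) 1 \ {0}), χ =ᶠ[𝓝 w] fun _ => 1 := by
  classical
  set D : Set ℂ := f '' (ball (0 : ℂ) 1 \ {0}) with hD
  set g := Function.invFunOn f (ball (0 : ℂ) 1)
  have hg : ∀ z ∈ ball (0 : ℂ) 1, g (f z) = z := fun z hz => hinj.leftInvOn_invFunOn hz
  have hpre : IsPreconnected (ball (0 : ℂ) 1) := (convex_ball _ _).isPreconnected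
  have hga := analyticOnNhd_leftInverse isOpen_ball hpre hf hg
  have hDo : IsOpen D := isOpen_image_of_injOn isOpen_ball hpre hf hinj sdiff_subset
    (isOpen_ball.sdiff isClosed_singleton)
  have hD0 : (0 : ℂ) ∉ D := by
    rintro ⟨z, hz, hz0⟩
    exact hz.2 (hinj hz.1 (mem_ball_self one_pos) (hz0.trans h0.symm))
  -- The point `w = 0` is omitted by `1 / f`; the convention `0⁻¹ = 0 ∉ D` gives it the value 1, as
  -- required.
  let χ : ℂ → ℝ := fun w => if w⁻¹ ∈ D then ψ (Complex.normSq (g w⁻¹)) else 1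
  have hone : ∀ w ∉ (fun z => (f z)⁻¹) '' (ball (0 : ℂ) 1 \ {0}), χ =ᶠ[𝓝 w] fun _ => 1 := by
    intro w hw
    have hwD : w⁻¹ ∉ D := by
      rintro ⟨z, hz, h⟩
      exact hw ⟨z, hz, by simp [h]⟩
    set B : Set ℂ := {z | Complex.normSq z ≤ b}
    have hB : B ⊆ ball 0 1 := by
      intro z hz
      have : ‖z‖ ^ 2 ≤ b := by rw [← Complex.normSq_eq_norm_sq]; exact hz
      rw [mem_ball_zero_iff]
      nlinarith [norm_nonneg z]
    have hBc : IsCompact B := by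
      refine (isCompact_closedBall (0 : ℂ) 1).of_isClosed_subset
        (isClosed_le Complex.continuous_normSq continuous_const) (hB.trans ball_subset_closedBall)
    have hK : IsCompact (f '' B) := hBc.image_of_continuousOn (hf.continuousOn.mono hB)
    -- By compactness of `f '' B`, points near an omitted `w` come only from `|z|² > b`, where `ψ =
    -- 1`, or are omitted themselves.
    have key : ∀ᶠ v in 𝓝 w, v = 0 ∨ v⁻¹ ∉ f '' B := by
      by_cases hw0 : w = 0
      · subst hw0
        obtain ⟨R, hR0, hR⟩ := hK.isBounded.exists_pos_norm_le
        filter_upwards [ball_mem_nhds (0 : ℂ) (inv_pos.2 hR0)] with v hv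
        by_contra! h
        have h1 := hR _ h.2
        have h2 : 0 < ‖v‖ := norm_pos_iff.2 h.1
        rw [norm_inv] at h1
        rw [mem_ball_zero_iff] at hv
        have := (lt_inv_comm₀ h2 hR0).1 hv
        linarith
      · have hwK : w⁻¹ ∉ f '' B := by
          rintro ⟨z, hz, h⟩
          refine hwD ⟨z, ⟨hB hz, ?_⟩, h⟩
          rintro rfl
          rw [h0] at h
          exact inv_ne_zero hw0 h.symm
        filter_upwards [(continuousAt_inv₀ hw0).eventually (hK.isClosed.isOpen_compl.mem_nhds hwK)]
          with v hv using Or.inr hv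
    filter_upwards [key] with v hv
    by_cases hvD : v⁻¹ ∈ D
    · simp only [χ, if_pos hvD]
      obtain ⟨z, hz, h⟩ := hvD
      rw [← h, hg z hz.1]
      apply hψb
      by_contra! hlt
      rcases hv with rfl | hv
      · exact hD0 ⟨z, hz, by simpa using h⟩
      · exact hv ⟨z, hlt.le, h⟩
    · simp [χ, hvD]
  refine ⟨χ, ?_, ?_, ?_, ?_, hone⟩
  · rw [contDiff_iff_contDiffAt]
    intro w
    by_cases hw : w⁻¹ ∈ D
    · have hw0 : w ≠ 0 := by rintro rfl; exact hD0 (by simpa using hw)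
      have hev : χ =ᶠ[𝓝 w] fun w => ψ (Complex.normSq (g w⁻¹)) := by
        filter_upwards [(continuousAt_inv₀ hw0).eventually (hDo.mem_nhds hw)] with v hv
        exact if_pos hv
      refine ContDiffAt.congr_of_eventuallyEq ?_ hev
      have h1 : AnalyticAt ℂ (fun w => g w⁻¹) w :=
        (hga _ (image_mono sdiff_subset hw)).fun_comp (analyticAt_inv hw0)
      have h2 : ContDiffAt ℝ 1 (fun w => g w⁻¹) w := (h1.restrictScalars (𝕜 := ℝ)).contDiffAt
      have h3 : ContDiff ℝ 1 (fun z : ℂ => Complex.normSq z) := by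
        simp only [Complex.normSq_eq_norm_sq]
        exact contDiff_norm_sq ℝ
      exact (hψ.comp h3).contDiffAt.comp w h2
    · exact contDiffAt_const.congr_of_eventuallyEq (hone w (by
        rintro ⟨z, hz, rfl⟩
        exact hw ⟨z, hz, by simp⟩))
  · set A : Set ℂ := ball 0 1 ∩ {z | Complex.normSq z < a}
    have hA : IsOpen (f '' A) := isOpen_image_of_injOn isOpen_ball hpre hf hinj inter_subset_left
      (isOpen_ball.inter (isOpen_lt Complex.continuous_normSq continuous_const))
    have h0A : (0 : ℂ) ∈ f '' A := ⟨0, ⟨mem_ball_self one_pos, by simpa using ha⟩, h0⟩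
    obtain ⟨δ, hδ, hball⟩ := Metric.isOpen_iff.1 hA 0 h0A
    refine HasCompactSupport.intro (isCompact_closedBall (0 : ℂ) δ⁻¹) fun w hw => ?_
    rw [mem_closedBall_zero_iff, not_le] at hw
    have hwpos : 0 < ‖w‖ := (inv_pos.2 hδ).trans hw
    have hwδ : w⁻¹ ∈ ball (0 : ℂ) δ := by
      rw [mem_ball_zero_iff, norm_inv]
      exact (inv_lt_comm₀ hδ hwpos).1 hw
    obtain ⟨z, hz, h⟩ := hball hwδ
    have hz0 : z ≠ 0 := by
      rintro rfl
      rw [h0] at h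
      exact inv_ne_zero (norm_pos_iff.1 hwpos) h.symm
    have hwD : w⁻¹ ∈ D := ⟨z, ⟨hz.1, hz0⟩, h⟩
    simp only [χ, if_pos hwD]
    rw [← h, hg z hz.1]
    exact hψa _ (le_of_lt hz.2)
  · intro w
    simp only [χ]
    split_ifs
    · exact hψ0 _
    · exact zero_le_one
  · intro z hz hz0
    have : f z ∈ D := ⟨z, ⟨hz, hz0⟩, rfl⟩
    simp only [χ, inv_inv, if_pos this, hg z hz]

/-- A weighted area theorem: Stokes' formula on the complement of the image of `1 / f`. -/
theorem re_setIntegral_vectorField_nonpos {f : ℂ → ℂ} (hf : AnalyticOnNhd ℂ f (ball 0 1))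
    (hinj : InjOn f (ball 0 1)) (h0 : f 0 = 0) {ψ : ℝ → ℝ} (hψ : ContDiff ℝ 1 ψ)
    (hψ0 : ∀ t, 0 ≤ ψ t) {a b : ℝ} (ha : 0 < a) (hb : b < 1) (hψa : ∀ t ≤ a, ψ t = 0)
    (hψb : ∀ t, b ≤ t → ψ t = 1) {V : ℂ → ℂ} (hV : ContDiff ℝ 1 V) (hVd : ∀ w, 0 ≤ (dbar V w).re) :
    (∫ z in ball (0 : ℂ) 1 \ {0}, ((deriv ψ (Complex.normSq z) : ℝ) : ℂ) *
      (z * (V (f z)⁻¹ * deriv (fun z => (f z)⁻¹) z))).re ≤ 0 := by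
  obtain ⟨χ, hχ, hχc, hχ0, hχf, hχ1⟩ := exists_cutoff hf hinj h0 hψ hψ0 ha hb hψa hψb
  set h : ℂ → ℂ := fun z => (f z)⁻¹ with hh
  set X : ℂ → ℂ := fun w => (χ w : ℂ) with hX
  set P : Set ℂ := ball (0 : ℂ) 1 \ {0} with hP
  have hPo : IsOpen P := isOpen_ball.sdiff isClosed_singleton
  have hXd : ContDiff ℝ 1 X := Complex.ofRealCLM.contDiff.comp hχ
  have hXc : HasCompactSupport X := hχc.comp_left (g := fun t : ℝ => (t : ℂ)) (by simp)
  have hf0 : ∀ z ∈ P, f z ≠ 0 := fun z hz hz0 =>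
    hz.2 (hinj hz.1 (mem_ball_self one_pos) (hz0.trans h0.symm))
  have hhd : ∀ z ∈ P, DifferentiableAt ℂ h z := fun z hz =>
    (hf z hz.1).differentiableAt.inv (hf0 z hz)
  have hhinj : InjOn h P := fun x hx y hy hxy => hinj hx.1 hy.1 (inv_injective hxy)
  have hprod := integral_dbar_eq_zero (hXd.mul hV) hXc.mul_right
  have hsplit : ∀ w, dbar (X * V) w = X w * dbar V w + V w * dbar X w := fun w =>
    dbar_mul (hXd.differentiable one_ne_zero w) (hV.differentiable one_ne_zero w)
  have hi1 : Integrable fun w => X w * dbar V w :=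
    (hXd.continuous.mul (continuous_dbar hV)).integrable_of_hasCompactSupport hXc.mul_right
  have hi2 : Integrable fun w => V w * dbar X w :=
    (hV.continuous.mul (continuous_dbar hXd)).integrable_of_hasCompactSupport
      (hasCompactSupport_dbar hXc).mul_left
  have hsum : (∫ w, X w * dbar V w) + ∫ w, V w * dbar X w = 0 := by
    rw [← integral_add hi1 hi2, ← hprod]
    exact integral_congr_ae (.of_forall fun w => (hsplit w).symm)
  have hpos : 0 ≤ (∫ w, X w * dbar V w).re := by
    have : (∫ w, X w * dbar V w).re = ∫ w, (X w * dbar V w).re := (integral_re hi1).symm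
    rw [this]
    refine integral_nonneg fun w => ?_
    simp only [hX, Complex.re_ofReal_mul]
    exact mul_nonneg (hχ0 w) (hVd w)
  have hout : ∫ w, V w * dbar X w = ∫ w in h '' P, V w * dbar X w := by
    refine (setIntegral_eq_integral_of_forall_compl_eq_zero fun w hw => ?_).symm
    have : X =ᶠ[𝓝 w] fun _ => (1 : ℂ) := by
      filter_upwards [hχ1 w hw] with v hv
      simp [hX, hv]
    simp [dbar, this.fderiv_eq]
  -- The Jacobian is `|h'|² = h' · conj h'`; the chain rule for `dbar` absorbs `conj h'`, leaving
  -- the explicit `dbar` of the radial profile.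
  have hcv : ∫ w in h '' P, V w * dbar X w =
      ∫ z in P, 2 * (((deriv ψ (Complex.normSq z) : ℝ) : ℂ) * (z * (V (h z) * deriv h z))) := by
    rw [integral_image_eq_integral_abs_det_fderiv_smul volume hPo.measurableSet
      (f' := fun z => (ContinuousLinearMap.toSpanSingleton ℂ (deriv h z)).restrictScalars ℝ)
      (fun z hz => ((hhd z hz).hasDerivAt.hasFDerivAt.restrictScalars ℝ).hasFDerivWithinAt) hhinj]
    refine setIntegral_congr_fun hPo.measurableSet fun z hz => ?_
    have hdet : ((ContinuousLinearMap.toSpanSingleton ℂ (deriv h z)).restrictScalars ℝ).det =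
        Complex.normSq (deriv h z) := by
      simp [ContinuousLinearMap.det, LinearMap.det_restrictScalars, Algebra.norm_complex_eq]
    have hchain : (starRingEnd ℂ) (deriv h z) * dbar X (h z) =
        2 * (deriv ψ (Complex.normSq z) * z) := by
      rw [← dbar_comp (hXd.differentiable one_ne_zero _) (hhd z hz), ← dbar_radial hψ]
      have : (fun z => X (h z)) =ᶠ[𝓝 z] fun z => (ψ (Complex.normSq z) : ℂ) := by
        filter_upwards [hPo.mem_nhds hz] with v hv
        simp only [hX, hh, hχf v hv.1 hv.2]
      simp only [dbar, this.fderiv_eq]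
    rw [hdet, abs_of_nonneg (Complex.normSq_nonneg _), Complex.real_smul,
      Complex.normSq_eq_conj_mul_self]
    linear_combination V (h z) * deriv h z * hchain
  rw [hout, hcv, integral_const_mul] at hsum
  have := congrArg Complex.re hsum
  simp only [Complex.add_re, Complex.mul_re, Complex.zero_re, Complex.re_ofNat, Complex.im_ofNat,
    zero_mul, sub_zero] at this
  linarith

end stokes

/-! ### Parseval with radial weights and the coefficient inequality. -/

section series

open Set Filter Topology MeasureTheory Metric

theorem summable_norm_taylorCoeff_mul_pow {g : ℂ → ℂ} (hg : AnalyticOnNhd ℂ g (ball 0 1)) {r : ℝ}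
    (hr0 : 0 ≤ r) (hr : r < 1) : Summable fun n => ‖taylorCoeff g n‖ * r ^ n := by
  have h := (hasSum_taylorCoeff hg (z := (r : ℂ))
    (by simpa [abs_of_nonneg hr0] using hr)).summable.norm
  simpa [abs_of_nonneg hr0] using h

theorem hasSum_integral_mul_pow {W : ℂ → ℂ} (hW : Integrable W) {r : ℝ} (hr0 : 0 ≤ r)
    (hr : r < 1) (hWr : ∀ z, r < ‖z‖ → W z = 0) {g : ℂ → ℂ}
    (hg : AnalyticOnNhd ℂ g (ball 0 1)) :
    HasSum (fun n => taylorCoeff g n * ∫ z, W z * z ^ n) (∫ z, W z * g z) := by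
  set F : ℕ → ℂ → ℂ := fun n z => taylorCoeff g n * (W z * z ^ n) with hF
  have hbound : ∀ n z, ‖F n z‖ ≤ ‖taylorCoeff g n‖ * r ^ n * ‖W z‖ := by
    intro n z
    simp only [hF, norm_mul, norm_pow]
    by_cases hz : r < ‖z‖
    · simp [hWr z hz]
    · have := pow_le_pow_left₀ (norm_nonneg z) (not_lt.1 hz) n
      calc ‖taylorCoeff g n‖ * (‖W z‖ * ‖z‖ ^ n) ≤ ‖taylorCoeff g n‖ * (‖W z‖ * r ^ n) := by gcongr
        _ = _ := by ring
  have hint : ∀ n, Integrable (F n) := fun n =>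
    (hW.norm.const_mul (‖taylorCoeff g n‖ * r ^ n)).mono'
      ((hW.1.mul (continuous_pow n).aestronglyMeasurable).const_mul _) (.of_forall (hbound n))
  have hsum : Summable fun n => ∫ z, ‖F n z‖ := by
    refine Summable.of_nonneg_of_le (fun n => integral_nonneg fun z => norm_nonneg _) (fun n => ?_)
      ((summable_norm_taylorCoeff_mul_pow hg hr0 hr).mul_right (∫ z, ‖W z‖))
    rw [← integral_const_mul]
    exact integral_mono (hint n).norm (hW.norm.const_mul _) (hbound n)
  have h := hasSum_integral_of_summable_integral_norm hint hsum
  have h1 : ∀ n, ∫ z, F n z = taylorCoeff g n * ∫ z, W z * z ^ n := fun n => integral_const_mul _ _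
  have h2 : ∫ z, ∑' n, F n z = ∫ z, W z * g z := by
    refine integral_congr_ae (.of_forall fun z => ?_)
    by_cases hz : r < ‖z‖
    · simp [hF, hWr z hz]
    · have hs := (hasSum_taylorCoeff hg (z := z)
        (by rw [mem_ball_zero_iff]; exact (not_lt.1 hz).trans_lt hr)).mul_left (W z)
      refine Eq.trans (tsum_congr fun n => ?_) hs.tsum_eq
      simp only [hF]
      ring
  simpa only [h1, h2] using h

/-- Rotation by `π / (k - j)` preserves the measure and changes the sign of the integrand. -/
theorem integral_radial_mul_conj_pow_mul_pow {φ : ℝ → ℝ} {j k : ℕ} (hjk : j ≠ k) :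
    ∫ z : ℂ, (φ (Complex.normSq z) : ℂ) * (starRingEnd ℂ) z ^ j * z ^ k = 0 := by
  set θ : ℝ := Real.pi / ((k : ℝ) - j) with hθ
  have hne : (k : ℝ) - j ≠ 0 := sub_ne_zero.2 (by exact_mod_cast hjk.symm)
  set G : ℂ → ℂ := fun z => (φ (Complex.normSq z) : ℂ) * (starRingEnd ℂ) z ^ j * z ^ k
  set c : Circle := Circle.exp θ
  have hc : (starRingEnd ℂ) (c : ℂ) ^ j * (c : ℂ) ^ k = -1 := by
    have h1 : (c : ℂ) = Complex.exp (θ * Complex.I) := Circle.coe_exp θ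
    have h2 : (starRingEnd ℂ) (c : ℂ) = Complex.exp (-(θ * Complex.I)) := by
      rw [h1, ← Complex.exp_conj]; simp
    rw [h2, h1, ← Complex.exp_nat_mul, ← Complex.exp_nat_mul, ← Complex.exp_add,
      ← Complex.exp_pi_mul_I]
    congr 1
    have : (θ : ℂ) * ((k : ℂ) - j) = Real.pi := by
      rw [hθ]
      exact_mod_cast div_mul_cancel₀ Real.pi hne
    linear_combination Complex.I * this
  have h := (rotation c).measurePreserving.integral_comp
    (rotation c).toHomeomorph.measurableEmbedding G
  have hG : ∀ z, G (rotation c z) = -G z := by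
    intro z
    simp only [G, rotation_apply, map_mul, mul_pow, Complex.normSq_eq_norm_sq, norm_mul,
      Circle.norm_coe, one_mul]
    linear_combination ((φ (‖z‖ ^ 2) : ℝ) : ℂ) * (starRingEnd ℂ) z ^ j * z ^ k * hc
  simp only [hG, integral_neg] at h
  change ∫ z, G z = 0
  exact self_eq_neg.1 h.symm

/-- Parseval's identity in the disc for a compactly supported radial weight. -/
theorem hasSum_radial_parseval {φ : ℝ → ℝ} (hφ : Continuous φ) {b : ℝ} (hb : b < 1)
    (hφb : ∀ t, b ≤ t → φ t = 0) {p q : ℂ → ℂ} (hp : AnalyticOnNhd ℂ p (ball 0 1))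
    (hq : AnalyticOnNhd ℂ q (ball 0 1)) :
    HasSum (fun k => (starRingEnd ℂ) (taylorCoeff q k) * taylorCoeff p k *
        ((∫ z : ℂ, φ (Complex.normSq z) * Complex.normSq z ^ k : ℝ) : ℂ))
      (∫ z, (φ (Complex.normSq z) : ℂ) * ((starRingEnd ℂ) (q z) * p z)) := by
  set r := Real.sqrt b with hr_def
  have hr0 : 0 ≤ r := Real.sqrt_nonneg b
  have hr : r < 1 := by rw [hr_def, Real.sqrt_lt' one_pos]; simpa using hb
  have hφr : ∀ z : ℂ, r < ‖z‖ → φ (Complex.normSq z) = 0 := by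
    intro z hz
    apply hφb
    rw [Complex.normSq_eq_norm_sq]
    exact (Real.sqrt_le_left (norm_nonneg z)).1 hz.le
  have hsub : closedBall (0 : ℂ) r ⊆ ball 0 1 := closedBall_subset_ball hr
  have hφc : Continuous fun z : ℂ => (φ (Complex.normSq z) : ℂ) :=
    Complex.continuous_ofReal.comp (hφ.comp Complex.continuous_normSq)
  have hint : ∀ G : ℂ → ℂ, ContinuousOn G (ball 0 1) →
      Integrable fun z => (φ (Complex.normSq z) : ℂ) * G z := by
    intro G hG
    rw [← integrableOn_iff_integrable_of_support_subset (s := closedBall (0 : ℂ) r)]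
    · exact (hφc.continuousOn.mul (hG.mono hsub)).integrableOn_compact (isCompact_closedBall _ _)
    · intro z hz
      rw [mem_closedBall_zero_iff]
      by_contra! h
      exact hz (by simp [hφr z h])
  have step : ∀ k, ∫ z, (φ (Complex.normSq z) : ℂ) * (starRingEnd ℂ) z ^ k * p z =
      taylorCoeff p k * ((∫ z : ℂ, φ (Complex.normSq z) * Complex.normSq z ^ k : ℝ) : ℂ) := by
    intro k
    have h := hasSum_integral_mul_pow
      (W := fun z => (φ (Complex.normSq z) : ℂ) * (starRingEnd ℂ) z ^ k)
      (hint (fun z => (starRingEnd ℂ) z ^ k) (by fun_prop)) hr0 hr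
      (fun z hz => by simp [hφr z hz]) hp
    refine h.unique ?_
    have hk : ∫ z, (φ (Complex.normSq z) : ℂ) * (starRingEnd ℂ) z ^ k * z ^ k =
        ((∫ z : ℂ, φ (Complex.normSq z) * Complex.normSq z ^ k : ℝ) : ℂ) := by
      rw [← integral_complex_ofReal]
      refine integral_congr_ae (.of_forall fun z => ?_)
      simp only [Complex.ofReal_mul, Complex.ofReal_pow, Complex.normSq_eq_conj_mul_self]
      ring
    rw [← hk]
    refine hasSum_single k fun n hn => ?_
    rw [integral_radial_mul_conj_pow_mul_pow hn.symm, mul_zero]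
  -- Here `q` is expanded against the conjugate of `p`; conjugating leaves the moments of `p`
  -- computed in `step`.
  have h := hasSum_integral_mul_pow
    (W := fun z => (φ (Complex.normSq z) : ℂ) * (starRingEnd ℂ) (p z))
    (hint _ (Complex.continuous_conj.comp_continuousOn hp.continuousOn)) hr0 hr
    (fun z hz => by simp [hφr z hz]) hq
  have h' := h.map (starRingEnd ℂ) Complex.continuous_conj
  convert h' using 1
  · funext k
    simp only [Function.comp_apply, map_mul, ← integral_conj, Complex.conj_ofReal, map_pow,
      Complex.conj_conj]
    rw [mul_assoc, ← step]
    congr 1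
    refine integral_congr_ae (.of_forall fun z => ?_)
    simp only
    ring
  · rw [← integral_conj]
    refine integral_congr_ae (.of_forall fun z => ?_)
    simp only [map_mul, Complex.conj_ofReal, Complex.conj_conj]
    ring

/-- The nonvanishing of the derivative somewhere makes the total mass of the radial weight positive,
so that it can be divided out. -/
theorem exists_radial_step {a b : ℝ} (hab : a < b) :
    ∃ ψ : ℝ → ℝ, ContDiff ℝ 1 ψ ∧ (∀ t, 0 ≤ ψ t) ∧ (∀ t ≤ a, ψ t = 0) ∧ (∀ t, b ≤ t → ψ t = 1) ∧
      (∀ t, 0 ≤ deriv ψ t) ∧ (∀ t ≤ a, deriv ψ t = 0) ∧ (∀ t, b ≤ t → deriv ψ t = 0) ∧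
      ∃ t, deriv ψ t ≠ 0 := by
  have hba : 0 < b - a := sub_pos.2 hab
  set ψ : ℝ → ℝ := fun t => Real.smoothTransition ((t - a) / (b - a)) with hψ
  have hd : ContDiff ℝ 1 ψ := by
    refine (Real.smoothTransition.contDiff (n := 1)).comp ?_
    fun_prop
  have h0 : ∀ t, 0 ≤ ψ t := fun t => Real.smoothTransition.nonneg _
  have h1 : ∀ t, ψ t ≤ 1 := fun t => Real.smoothTransition.le_one _
  have ha : ∀ t ≤ a, ψ t = 0 := fun t ht =>
    Real.smoothTransition.zero_of_nonpos (div_nonpos_of_nonpos_of_nonneg (by linarith) hba.le)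
  have hb : ∀ t, b ≤ t → ψ t = 1 := fun t ht =>
    Real.smoothTransition.one_of_one_le ((one_le_div hba).2 (by linarith))
  have hmono : Monotone ψ := fun s t hst =>
    Real.smoothTransition.monotone (by gcongr)
  refine ⟨ψ, hd, h0, ha, hb, fun t => hmono.deriv_nonneg, fun t ht => ?_, fun t ht => ?_, ?_⟩
  · exact IsLocalMin.deriv_eq_zero (.of_forall fun s => by rw [ha t ht]; exact h0 s)
  · exact IsLocalMax.deriv_eq_zero (.of_forall fun s => by rw [hb t ht]; exact h1 s)
  · by_contra! h
    have := is_const_of_deriv_eq_zero (hd.differentiable one_ne_zero) h a b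
    rw [ha a le_rfl, hb b le_rfl] at this
    exact zero_ne_one this

variable {f : ℂ → ℂ}

/-- Stokes and Parseval give `∑ (kα - 1) |q_k|² M_k ≤ 0`, where `M_k` is the `k`-th moment of the
weight. The term `k = 0` is `-M_0`, and the weight lives on `|z|² ≥ a`, so `M_k ≥ a^k M_0`. The
factor `‖z‖⁻¹ ^ N` is radial and joins the weight, so `N` is irrelevant to the bound. -/
theorem weighted_coeff_bound_aux (hf : AnalyticOnNhd ℂ f (ball 0 1))
    (hinj : InjOn f (ball 0 1)) (h0 : f 0 = 0) {V : ℂ → ℂ} (hV : ContDiff ℝ 1 V)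
    (hVd : ∀ w, 0 ≤ (dbar V w).re) {q : ℂ → ℂ} (hq : AnalyticOnNhd ℂ q (ball 0 1)) (hq0 : q 0 = 1)
    {α : ℝ} (hα : 1 / 2 ≤ α) (hq1 : (α - 1) * ‖taylorCoeff q 1‖ ^ 2 = 0) (N : ℕ)
    (hVq : ∀ z ∈ ball (0 : ℂ) 1, z ≠ 0 → z * (V (f z)⁻¹ * deriv (fun z => (f z)⁻¹) z) =
      ((‖z‖⁻¹ ^ N : ℝ) : ℂ) * ((starRingEnd ℂ) (q z) * (α * (z * deriv q z) - q z)))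
    {a : ℝ} (ha0 : 0 < a) (ha1 : a < 1) :
    (2 * α - 1) * ‖taylorCoeff q 2‖ ^ 2 * a ^ 2 + (3 * α - 1) * ‖taylorCoeff q 3‖ ^ 2 * a ^ 3 +
      (4 * α - 1) * ‖taylorCoeff q 4‖ ^ 2 * a ^ 4 ≤ 1 := by
  set b : ℝ := (1 + a) / 2 with hb_def
  have hab : a < b := by linarith
  have hb1 : b < 1 := by linarith
  obtain ⟨ψ, hψ, hψ0, hψa, hψb, hψ', hψ'a, hψ'b, t₀, ht₀⟩ := exists_radial_step hab
  -- The maximum keeps the weight continuous at 0 and changes nothing where `ψ' ≠ 0`.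
  set φ : ℝ → ℝ := fun t => deriv ψ t * ((Real.sqrt (max t a))⁻¹) ^ N with hφ_def
  have hmax : ∀ t, 0 < Real.sqrt (max t a) := fun t =>
    Real.sqrt_pos.2 (ha0.trans_le (le_max_right _ _))
  have hφc : Continuous φ := by
    refine (hψ.continuous_deriv le_rfl).mul (Continuous.pow (Continuous.inv₀ ?_ fun t =>
      (hmax t).ne') N)
    fun_prop
  have hφ0 : ∀ t, 0 ≤ φ t := fun t => mul_nonneg (hψ' t) (pow_nonneg (inv_nonneg.2 (hmax t).le) N)
  have hφa : ∀ t ≤ a, φ t = 0 := fun t ht => by simp [hφ_def, hψ'a t ht]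
  have hφb : ∀ t, b ≤ t → φ t = 0 := fun t ht => by simp [hφ_def, hψ'b t ht]
  set p : ℂ → ℂ := fun z => α * (z * deriv q z) - q z with hp_def
  have hp : AnalyticOnNhd ℂ p (ball 0 1) := by
    intro z hz
    have h1 := (hq z hz).deriv
    have h2 := hq z hz
    simp only [hp_def]
    fun_prop
  have h0mem : (0 : ℂ) ∈ ball (0 : ℂ) 1 := mem_ball_self one_pos
  have hstokes := re_setIntegral_vectorField_nonpos hf hinj h0 hψ hψ0 ha0 hb1 hψa hψb hV hVd
  have hint : ∫ z in ball (0 : ℂ) 1 \ {0}, ((deriv ψ (Complex.normSq z) : ℝ) : ℂ) *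
      (z * (V (f z)⁻¹ * deriv (fun z => (f z)⁻¹) z)) =
      ∫ z, (φ (Complex.normSq z) : ℂ) * ((starRingEnd ℂ) (q z) * p z) := by
    refine Eq.trans ?_
      (setIntegral_eq_integral_of_forall_compl_eq_zero (s := ball (0 : ℂ) 1 \ {0}) ?_)
    · refine setIntegral_congr_fun
        (measurableSet_ball.diff (measurableSet_singleton 0)) fun z hz => ?_
      rw [hVq z hz.1 hz.2]
      rcases le_total (Complex.normSq z) a with hza | hza
      · simp [hφa _ hza, hψ'a _ hza]
      · rw [Complex.normSq_eq_norm_sq] at hza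
        simp only [hφ_def, hp_def, Complex.normSq_eq_norm_sq, max_eq_left hza,
          Real.sqrt_sq (norm_nonneg z)]
        push_cast
        ring
    · intro z hz
      by_cases hz0 : z = 0
      · simp [hz0, hφa 0 ha0.le]
      · have : 1 ≤ ‖z‖ := by
          by_contra! h
          exact hz ⟨mem_ball_zero_iff.2 h, hz0⟩
        have hz1 : b ≤ Complex.normSq z := by
          rw [Complex.normSq_eq_norm_sq]; nlinarith
        simp [hφb _ hz1]
  rw [hint] at hstokes
  clear hint
  set M : ℕ → ℝ := fun k => ∫ z : ℂ, φ (Complex.normSq z) * Complex.normSq z ^ k with hM_def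
  have hcont : ∀ k, Continuous fun z : ℂ => φ (Complex.normSq z) * Complex.normSq z ^ k := fun k =>
    (hφc.comp Complex.continuous_normSq).mul (Complex.continuous_normSq.pow k)
  have hsupp : ∀ k, HasCompactSupport fun z : ℂ => φ (Complex.normSq z) * Complex.normSq z ^ k := by
    intro k
    refine HasCompactSupport.intro (isCompact_closedBall (0 : ℂ) 1) fun z hz => ?_
    rw [mem_closedBall_zero_iff, not_le] at hz
    rw [hφb _ (by rw [Complex.normSq_eq_norm_sq]; nlinarith), zero_mul]
  have hMi : ∀ k, Integrable fun z : ℂ => φ (Complex.normSq z) * Complex.normSq z ^ k := fun k =>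
    (hcont k).integrable_of_hasCompactSupport (hsupp k)
  have hMk : ∀ k, a ^ k * M 0 ≤ M k := by
    intro k
    simp only [hM_def]
    rw [← integral_const_mul]
    refine integral_mono ((hMi 0).const_mul _) (hMi k) fun z => ?_
    simp only [pow_zero, mul_one]
    rcases le_total (Complex.normSq z) a with hza | hza
    · simp [hφa _ hza]
    · rw [mul_comm]
      exact mul_le_mul_of_nonneg_left (pow_le_pow_left₀ ha0.le hza k) (hφ0 _)
  have hM0 : 0 < M 0 := by
    have ht₀a : a < t₀ := by
      by_contra! h
      exact ht₀ (hψ'a t₀ h)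
    refine (hcont 0).integral_pos_of_hasCompactSupport_nonneg_nonzero (hsupp 0)
      (x := (Real.sqrt t₀ : ℂ)) (fun z => by simpa using hφ0 _) ?_
    have : Complex.normSq (Real.sqrt t₀ : ℂ) = t₀ := by
      rw [Complex.normSq_ofReal, Real.mul_self_sqrt (ha0.trans ht₀a).le]
    simp only [this, pow_zero, mul_one, hφ_def]
    exact mul_ne_zero ht₀ (pow_ne_zero _ (inv_ne_zero (hmax t₀).ne'))
  have hsum := Complex.hasSum_re (hasSum_radial_parseval hφc hb1 hφb hp hq)
  have hterm : ∀ k, ((starRingEnd ℂ) (taylorCoeff q k) * taylorCoeff p k * (M k : ℂ)).re =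
      (k * α - 1) * ‖taylorCoeff q k‖ ^ 2 * M k := by
    intro k
    rw [taylorCoeff_euler (hq 0 h0mem)]
    have : (starRingEnd ℂ) (taylorCoeff q k) * (((α : ℂ) * k - 1) * taylorCoeff q k) * (M k : ℂ) =
        (((k * α - 1) * ‖taylorCoeff q k‖ ^ 2 * M k : ℝ) : ℂ) := by
      push_cast
      rw [← Complex.conj_mul']
      ring
    rw [this, Complex.ofReal_re]
  have hsum' : HasSum (fun k : ℕ => (k * α - 1) * ‖taylorCoeff q k‖ ^ 2 * M k) _ :=
    hsum.congr_fun fun k => (hterm k).symm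
  -- The discarded terms are nonnegative because `α ≥ 1/2`.
  have hle := sum_le_hasSum (Finset.range 5) (fun k hk => by
    have hk5 : (5 : ℝ) ≤ k := by
      have : 5 ≤ k := by simpa using hk
      exact_mod_cast this
    have hMk0 : 0 ≤ M k := (mul_nonneg (pow_nonneg ha0.le k) hM0.le).trans (hMk k)
    exact mul_nonneg (mul_nonneg (by nlinarith) (sq_nonneg _)) hMk0) hsum'
  have hle' := hle.trans hstokes
  simp only [Finset.sum_range_succ, Finset.sum_range_zero, taylorCoeff_zero, hq0] at hle'
  push_cast at hle'
  simp only [norm_one] at hle'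
  -- Only `k = 1` could have the wrong sign; `hq1` removes it.
  have e1 : (α - 1) * ‖taylorCoeff q 1‖ ^ 2 * M 1 = 0 := by rw [hq1, zero_mul]
  have e2 := mul_le_mul_of_nonneg_left (hMk 2)
    (mul_nonneg (by linarith : 0 ≤ 2 * α - 1) (sq_nonneg ‖taylorCoeff q 2‖))
  have e3 := mul_le_mul_of_nonneg_left (hMk 3)
    (mul_nonneg (by linarith : 0 ≤ 3 * α - 1) (sq_nonneg ‖taylorCoeff q 3‖))
  have e4 := mul_le_mul_of_nonneg_left (hMk 4)
    (mul_nonneg (by linarith : 0 ≤ 4 * α - 1) (sq_nonneg ‖taylorCoeff q 4‖))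
  refine le_of_mul_le_mul_right ?_ hM0
  linarith

/-- The area theorem for `1 / f` with respect to the vector field `V`, truncated at order four. -/
theorem weighted_coeff_bound (hf : AnalyticOnNhd ℂ f (ball 0 1))
    (hinj : InjOn f (ball 0 1)) (h0 : f 0 = 0) {V : ℂ → ℂ} (hV : ContDiff ℝ 1 V)
    (hVd : ∀ w, 0 ≤ (dbar V w).re) {q : ℂ → ℂ} (hq : AnalyticOnNhd ℂ q (ball 0 1)) (hq0 : q 0 = 1)
    {α : ℝ} (hα : 1 / 2 ≤ α) (hq1 : (α - 1) * ‖taylorCoeff q 1‖ ^ 2 = 0) (N : ℕ)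
    (hVq : ∀ z ∈ ball (0 : ℂ) 1, z ≠ 0 → z * (V (f z)⁻¹ * deriv (fun z => (f z)⁻¹) z) =
      ((‖z‖⁻¹ ^ N : ℝ) : ℂ) * ((starRingEnd ℂ) (q z) * (α * (z * deriv q z) - q z))) :
    (2 * α - 1) * ‖taylorCoeff q 2‖ ^ 2 + (3 * α - 1) * ‖taylorCoeff q 3‖ ^ 2 +
      (4 * α - 1) * ‖taylorCoeff q 4‖ ^ 2 ≤ 1 := by
  set F : ℝ → ℝ := fun a => (2 * α - 1) * ‖taylorCoeff q 2‖ ^ 2 * a ^ 2 +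
    (3 * α - 1) * ‖taylorCoeff q 3‖ ^ 2 * a ^ 3 + (4 * α - 1) * ‖taylorCoeff q 4‖ ^ 2 * a ^ 4
    with hF
  have hFc : Continuous F := by fun_prop
  have hlim : Tendsto F (𝓝[<] 1) (𝓝 (F 1)) := hFc.continuousWithinAt
  have : F 1 ≤ 1 := by
    refine le_of_tendsto hlim ?_
    filter_upwards [Ioo_mem_nhdsLT (zero_lt_one (α := ℝ))] with a ha
    exact weighted_coeff_bound_aux hf hinj h0 hV hVd hq hq0 hα hq1 N hVq ha.1 ha.2
  simpa [hF] using this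

end series

/-! ### The two vector fields and the two area inequalities. -/

section schlicht

open Set Filter Topology Metric ComplexConjugate

/-- Take `v = exp (L / 2)` with `L` a primitive of `u' / u`; then `u exp (-L)` is constant. -/
theorem exists_analytic_sqrt {u : ℂ → ℂ} (hu : AnalyticOnNhd ℂ u (ball 0 1))
    (hne : ∀ z ∈ ball (0 : ℂ) 1, u z ≠ 0) (hu0 : u 0 = 1) :
    ∃ v : ℂ → ℂ, AnalyticOnNhd ℂ v (ball 0 1) ∧ v 0 = 1 ∧ ∀ z ∈ ball (0 : ℂ) 1, v z ^ 2 = u z := by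
  have hd : DifferentiableOn ℂ (fun z => deriv u z / u z) (ball 0 1) := fun z hz =>
    ((hu z hz).deriv.differentiableAt.div (hu z hz).differentiableAt
      (hne z hz)).differentiableWithinAt
  obtain ⟨L, hL0, hL⟩ := hd.isExactOn_ball.with_val_at 0 0
  have hLa : AnalyticOnNhd ℂ L (ball 0 1) := DifferentiableOn.analyticOnNhd
    (fun z hz => (hL z hz).differentiableAt.differentiableWithinAt) isOpen_ball
  refine ⟨fun z => Complex.exp (L z / 2), fun z hz => ?_, by simp [hL0], fun z hz => ?_⟩
  · exact (hLa z hz).div analyticAt_const two_ne_zero |>.cexp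
  · have hder : ∀ w ∈ ball (0 : ℂ) 1, HasDerivAt (fun w => u w * Complex.exp (-L w)) 0 w := by
      intro w hw
      refine ((hu w hw).differentiableAt.hasDerivAt.mul (hL w hw).neg.cexp).congr_deriv ?_
      field_simp [hne w hw]
      ring
    have hconst := (convex_ball (0 : ℂ) 1).is_const_of_fderivWithin_eq_zero (𝕜 := ℂ)
      (f := fun w => u w * Complex.exp (-L w))
      (fun w hw => (hder w hw).differentiableAt.differentiableWithinAt)
      (fun w hw => by
        rw [fderivWithin_of_isOpen isOpen_ball hw]
        ext
        simpa using (hder w hw).deriv) hz (mem_ball_self one_pos)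
    simp only [hL0, hu0, neg_zero, Complex.exp_zero, mul_one] at hconst
    have hu' : u z = Complex.exp (L z) := by
      rw [Complex.exp_neg, ← div_eq_mul_inv, div_eq_one_iff_eq (Complex.exp_ne_zero _)] at hconst
      exact hconst
    rw [hu', ← Complex.exp_nat_mul]
    congr 1
    push_cast
    ring

theorem contDiff_conj : ContDiff ℝ 1 fun w : ℂ => conj w :=
  Complex.conjCLE.contDiff

theorem dbar_conj (w : ℂ) : dbar (fun w => conj w) w = 2 := by
  have : HasFDerivAt (fun w : ℂ => conj w) (Complex.conjCLE : ℂ →L[ℝ] ℂ) w :=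
    Complex.conjCLE.hasFDerivAt
  rw [dbar, this.fderiv]
  simp
  norm_num

/-- The derivative of `w ↦ conj w * ‖w‖`. -/
noncomputable def conjMulNormDeriv (w : ℂ) : ℂ →L[ℝ] ℂ :=
  ‖w‖ • (Complex.conjCLE : ℂ →L[ℝ] ℂ) + (innerSL ℝ w).smulRight (((‖w‖⁻¹ : ℝ) : ℂ) * conj w)

theorem hasFDerivAt_conj_mul_norm (w : ℂ) :
    HasFDerivAt (fun w : ℂ => conj w * (‖w‖ : ℂ)) (conjMulNormDeriv w) w := by
  by_cases hw : w = 0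
  · subst hw
    -- The convention `0⁻¹ = 0` gives the formula its correct value at the origin.
    have h0 : conjMulNormDeriv 0 = 0 := by ext; simp [conjMulNormDeriv]
    rw [h0, hasFDerivAt_iff_isLittleO_nhds_zero]
    simp only [zero_add, map_zero, norm_zero, Complex.ofReal_zero, mul_zero, sub_zero,
      _root_.zero_apply]
    have h1 : (fun h : ℂ => conj h) =O[𝓝 0] fun h => h :=
      Asymptotics.isBigO_of_le _ fun h => by simp
    have h2 : (fun h : ℂ => (‖h‖ : ℂ)) =o[𝓝 0] fun _ => (1 : ℂ) := by
      rw [Asymptotics.isLittleO_one_iff]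
      exact Continuous.tendsto' (by fun_prop) _ _ (by simp)
    simpa using h1.mul_isLittleO h2
  · have hn : HasFDerivAt (fun w : ℂ => ‖w‖) (‖w‖⁻¹ • innerSL ℝ w) w := by
      have h1 := (hasStrictFDerivAt_norm_sq (F := ℂ) w).hasFDerivAt
      have h2 := h1.sqrt (by positivity)
      refine (h2.congr_fderiv ?_).congr_of_eventuallyEq (.of_forall fun v => by
        simp [Real.sqrt_sq])
      rw [Real.sqrt_sq (norm_nonneg w)]
      ext v
      simp
      ring
    have h3 := (Complex.conjCLE.hasFDerivAt (x := w)).mul (Complex.ofRealCLM.hasFDerivAt.comp w hn)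
    refine h3.congr_fderiv ?_
    ext v
    simp [conjMulNormDeriv]
    ring

theorem contDiff_conj_mul_norm : ContDiff ℝ 1 fun w : ℂ => conj w * (‖w‖ : ℂ) := by
  rw [contDiff_one_iff_hasFDerivAt]
  refine ⟨conjMulNormDeriv, ?_, hasFDerivAt_conj_mul_norm⟩
  rw [continuous_iff_continuousAt]
  intro w
  have h1 : ContinuousAt (fun w : ℂ => ‖w‖ • (Complex.conjCLE : ℂ →L[ℝ] ℂ)) w := by fun_prop
  refine h1.add ?_
  by_cases hw : w = 0
  · subst hw
    rw [ContinuousAt]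
    have : (innerSL ℝ (0 : ℂ)).smulRight (((‖(0 : ℂ)‖⁻¹ : ℝ) : ℂ) * conj (0 : ℂ)) = 0 := by
      ext; simp
    rw [this]
    refine squeeze_zero_norm (a := fun w => ‖w‖) (fun v => ?_) (by
      exact Continuous.tendsto' continuous_norm _ _ norm_zero)
    rw [ContinuousLinearMap.norm_smulRight_apply, innerSL_apply_norm]
    by_cases hv : v = 0
    · simp [hv]
    · have : ‖v‖ ≠ 0 := norm_ne_zero_iff.2 hv
      simp [this]
  · have hc : ContinuousAt (fun w : ℂ => (((‖w‖⁻¹ : ℝ) : ℂ) * conj w)) w := by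
      have := norm_ne_zero_iff.2 hw
      fun_prop (disch := assumption)
    have h := ((ContinuousLinearMap.smulRightL ℝ ℂ ℂ).continuous.comp
      (innerSL ℝ (E := ℂ)).continuous).continuousAt (x := w)
    exact h.clm_apply hc

theorem re_dbar_conj_mul_norm_nonneg (w : ℂ) : 0 ≤ (dbar (fun w => conj w * (‖w‖ : ℂ)) w).re := by
  have : (dbar (fun w => conj w * (‖w‖ : ℂ)) w).re = 2 * ‖w‖ + ‖w‖⁻¹ * ‖w‖ ^ 2 := by
    rw [dbar, (hasFDerivAt_conj_mul_norm w).fderiv, ← Complex.normSq_eq_norm_sq,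
      Complex.normSq_apply]
    simp [conjMulNormDeriv]
    ring
  rw [this]
  positivity

/-- The factorization `f z = z / u z` of a schlicht function. -/
theorem SchlichtClass.exists_quotient {f : ℂ → ℂ} (hf : SchlichtClass f) :
    ∃ u : ℂ → ℂ, AnalyticOnNhd ℂ u (ball 0 1) ∧ (∀ z ∈ ball (0 : ℂ) 1, u z ≠ 0) ∧ u 0 = 1 ∧
      (∀ z ∈ ball (0 : ℂ) 1, (f z)⁻¹ = u z / z) ∧ ∀ z ∈ ball (0 : ℂ) 1, u z * f z = z := by
  have h0 : (0 : ℂ) ∈ ball (0 : ℂ) 1 := mem_ball_self one_pos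
  have hk : AnalyticOnNhd ℂ (dslope f 0) (ball 0 1) :=
    DifferentiableOn.analyticOnNhd ((Complex.differentiableOn_dslope
      (isOpen_ball.mem_nhds h0)).2 hf.analytic.differentiableOn) isOpen_ball
  have hk0 : dslope f 0 0 = 1 := by rw [dslope_same, hf.deriv_zero]
  have hkf : ∀ z, f z = z * dslope f 0 z := by
    intro z
    have := sub_smul_dslope f 0 z
    simpa [hf.map_zero] using this.symm
  have hkne : ∀ z ∈ ball (0 : ℂ) 1, dslope f 0 z ≠ 0 := by
    intro z hz h
    by_cases hz0 : z = 0
    · rw [hz0, hk0] at h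
      exact one_ne_zero h
    · refine hz0 (hf.univalent hz h0 ?_)
      rw [hf.map_zero, hkf z, h, mul_zero]
  refine ⟨fun z => (dslope f 0 z)⁻¹, fun z hz => (hk z hz).inv (hkne z hz),
    fun z hz => inv_ne_zero (hkne z hz), by simp only [hk0, inv_one],
    fun z hz => ?_, fun z hz => ?_⟩
  · rw [hkf z, mul_inv, div_eq_mul_inv, mul_comm]
  · have := hkne z hz
    rw [hkf z]
    field_simp

theorem SchlichtClass.deriv_inv {f u : ℂ → ℂ} (hu : AnalyticOnNhd ℂ u (ball 0 1))
    (huf : ∀ z ∈ ball (0 : ℂ) 1, (f z)⁻¹ = u z / z) {z : ℂ} (hz : z ∈ ball (0 : ℂ) 1)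
    (hz0 : z ≠ 0) : deriv (fun z => (f z)⁻¹) z = (deriv u z * z - u z) / z ^ 2 := by
  have : (fun z => (f z)⁻¹) =ᶠ[𝓝 z] fun z => u z / z := by
    filter_upwards [isOpen_ball.mem_nhds hz] with v hv using huf v hv
  rw [this.deriv_eq, deriv_fun_div (hu z hz).differentiableAt differentiableAt_fun_id hz0]
  simp

theorem SchlichtClass.area_bound {f u : ℂ → ℂ} (hf : SchlichtClass f)
    (hu : AnalyticOnNhd ℂ u (ball 0 1)) (hu0 : u 0 = 1)
    (huf : ∀ z ∈ ball (0 : ℂ) 1, (f z)⁻¹ = u z / z) :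
    ‖taylorCoeff u 2‖ ^ 2 + 2 * ‖taylorCoeff u 3‖ ^ 2 + 3 * ‖taylorCoeff u 4‖ ^ 2 ≤ 1 := by
  -- With `V w = conj w`, one has `q = u`, `α = 1`; the linear term drops out by itself.
  have h := weighted_coeff_bound hf.analytic hf.univalent hf.map_zero contDiff_conj
    (fun w => by rw [dbar_conj]; norm_num) hu hu0 (α := 1) (by norm_num) (by simp) 2 ?_
  · linarith
  · intro z hz hz0
    have hcz : conj z ≠ 0 := by simpa using hz0
    have hn : ((‖z‖⁻¹ ^ 2 : ℝ) : ℂ) = (conj z * z)⁻¹ := by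
      rw [Complex.conj_mul']; push_cast; rw [inv_pow]
    rw [SchlichtClass.deriv_inv hu huf hz hz0, huf z hz, hn, map_div₀]
    field_simp
    push_cast
    ring

/-- For `V w = conj w |w|` and `q = v³`, the identity `q' = 3 v² v'` forces `α = 2/3`. Then the
coefficient `3α - 1` of `|q₃|²` is exactly 1. -/
theorem SchlichtClass.weighted_area_bound {f u v : ℂ → ℂ} (hf : SchlichtClass f)
    (hu : AnalyticOnNhd ℂ u (ball 0 1)) (huf : ∀ z ∈ ball (0 : ℂ) 1, (f z)⁻¹ = u z / z)
    (hv : AnalyticOnNhd ℂ v (ball 0 1)) (hv0 : v 0 = 1)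
    (hvu : ∀ z ∈ ball (0 : ℂ) 1, v z ^ 2 = u z)
    (h1 : taylorCoeff (fun z => v z * (v z * v z)) 1 = 0) :
    ‖taylorCoeff (fun z => v z * (v z * v z)) 3‖ ≤ 1 := by
  have hq : AnalyticOnNhd ℂ (fun z => v z * (v z * v z)) (ball 0 1) := fun z hz =>
    (hv z hz).fun_mul ((hv z hz).fun_mul (hv z hz))
  have h := weighted_coeff_bound hf.analytic hf.univalent hf.map_zero contDiff_conj_mul_norm
    re_dbar_conj_mul_norm_nonneg hq (by simp [hv0]) (α := 2 / 3) (by norm_num) (by simp [h1]) 3 ?_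
  · nlinarith [sq_nonneg ‖taylorCoeff (fun z => v z * (v z * v z)) 2‖,
      sq_nonneg ‖taylorCoeff (fun z => v z * (v z * v z)) 4‖,
      norm_nonneg (taylorCoeff (fun z => v z * (v z * v z)) 3)]
  · intro z hz hz0
    have hcz : conj z ≠ 0 := by simpa using hz0
    have hnz : (‖z‖ : ℂ) ≠ 0 := by simpa using hz0
    have hvd := (hv z hz).differentiableAt.hasDerivAt
    have hud : deriv u z = 2 * v z * deriv v z := by
      have : u =ᶠ[𝓝 z] fun z => v z * v z := by
        filter_upwards [isOpen_ball.mem_nhds hz] with w hw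
        rw [← hvu w hw, sq]
      rw [this.deriv_eq, (hvd.fun_mul hvd).deriv]
      ring
    have hqd : deriv (fun z => v z * (v z * v z)) z = 3 * v z ^ 2 * deriv v z := by
      rw [(hvd.fun_mul (hvd.fun_mul hvd)).deriv]
      ring
    have hnorm : ((‖v z ^ 2 / z‖ : ℝ) : ℂ) = conj (v z) * v z / ‖z‖ := by
      rw [norm_div, norm_pow, Complex.conj_mul']
      push_cast
      ring
    have hz2 : (‖z‖ : ℂ) ^ 2 = conj z * z := (Complex.conj_mul' z).symm
    have hn : ((‖z‖⁻¹ ^ 3 : ℝ) : ℂ) = (conj z * z * ‖z‖)⁻¹ := by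
      rw [← hz2]; push_cast; rw [inv_pow]; congr 1
    rw [SchlichtClass.deriv_inv hu huf hz hz0, huf z hz, hud, hqd, hn, ← hvu z hz, hnorm, map_div₀,
      map_pow, map_mul, map_mul]
    push_cast
    field_simp

end schlicht

/-! ### Coefficient comparison and the final estimates. -/

theorem theorem2p1 (f : ℂ → ℂ) (hf : SchlichtClass f) (ha₂ : taylorCoeff f 2 = 0) :
    ‖taylorCoeff f 3‖ ≤ 1 ∧
    ‖taylorCoeff f 4‖ ≤ 2 / 3 ∧
    ‖taylorCoeff f 5‖ ≤ Real.sqrt (19 / 15) ∧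
    ‖hankelTwoTwo f‖ ≤ 1 ∧
    ‖hankelThreeOne f‖ ≤ 21 / 20 := by
  obtain ⟨u, hu, hune, hu0, huf, hmul⟩ := hf.exists_quotient
  obtain ⟨v, hv, hv0, hvu⟩ := exists_analytic_sqrt hu hune hu0
  have h0 : (0 : ℂ) ∈ Metric.ball (0 : ℂ) 1 := Metric.mem_ball_self one_pos
  have hu0' : taylorCoeff u 0 = 1 := by rw [taylorCoeff_zero, hu0]
  have hv0' : taylorCoeff v 0 = 1 := by rw [taylorCoeff_zero, hv0]
  have hf0 : taylorCoeff f 0 = 0 := by rw [taylorCoeff_zero, hf.map_zero]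
  have hf1 : taylorCoeff f 1 = 1 := by rw [taylorCoeff_one, hf.deriv_zero]
  -- Coefficients of the identity `u f = z`.
  have hcu : ∀ n, ∑ i ∈ Finset.range (n + 1), taylorCoeff u i * taylorCoeff f (n - i) =
      if n = 1 then 1 else 0 := by
    intro n
    rw [← taylorCoeff_mul (hu 0 h0) (hf.analytic 0 h0), ← taylorCoeff_id]
    refine taylorCoeff_congr ?_ n
    filter_upwards [Metric.isOpen_ball.mem_nhds h0] with z hz using hmul z hz
  have hcv : ∀ n, ∑ i ∈ Finset.range (n + 1), taylorCoeff v i * taylorCoeff v (n - i) =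
      taylorCoeff u n := by
    intro n
    rw [← taylorCoeff_mul (hv 0 h0) (hv 0 h0)]
    refine taylorCoeff_congr ?_ n
    filter_upwards [Metric.isOpen_ball.mem_nhds h0] with z hz
    rw [← hvu z hz, sq]
  have hcq : ∀ n, taylorCoeff (fun z => v z * (v z * v z)) n =
      ∑ i ∈ Finset.range (n + 1), taylorCoeff v i * taylorCoeff u (n - i) := by
    intro n
    rw [taylorCoeff_mul (hv 0 h0) ((hv 0 h0).fun_mul (hv 0 h0))]
    refine Finset.sum_congr rfl fun i _ => ?_
    rw [← hcv (n - i), taylorCoeff_mul (hv 0 h0) (hv 0 h0)]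
  have hu1 : taylorCoeff u 1 = 0 := by
    have := hcu 2
    simp [Finset.sum_range_succ, hf0, hf1, ha₂] at this
    exact this
  have hu2 : taylorCoeff u 2 = -taylorCoeff f 3 := by
    have := hcu 3
    simp [Finset.sum_range_succ, hf0, hf1, ha₂, hu0', hu1] at this
    linear_combination this
  have hu3 : taylorCoeff u 3 = -taylorCoeff f 4 := by
    have := hcu 4
    simp [Finset.sum_range_succ, hf0, hf1, ha₂, hu0', hu1] at this
    linear_combination this
  have hu4 : taylorCoeff u 4 = -(taylorCoeff f 5 - taylorCoeff f 3 ^ 2) := by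
    have := hcu 5
    simp [Finset.sum_range_succ, hf0, hf1, ha₂, hu0', hu1, hu2] at this
    linear_combination this
  have hv1 : taylorCoeff v 1 = 0 := by
    have := hcv 1
    simp [Finset.sum_range_succ, hv0', hu1] at this
    exact this
  have hv3 : 2 * taylorCoeff v 3 = -taylorCoeff f 4 := by
    have := hcv 3
    simp [Finset.sum_range_succ, hv0', hv1, hu3] at this
    linear_combination this
  have hq1 : taylorCoeff (fun z => v z * (v z * v z)) 1 = 0 := by
    rw [hcq]
    simp [Finset.sum_range_succ, hv1, hu1]
  have hq3 : taylorCoeff (fun z => v z * (v z * v z)) 3 = -(3 / 2) * taylorCoeff f 4 := by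
    rw [hcq]
    simp [Finset.sum_range_succ, hv0', hv1, hu0', hu1, hu3]
    linear_combination hv3 / 2
  have harea := hf.area_bound hu hu0 huf
  rw [hu2, hu3, hu4, norm_neg, norm_neg, norm_neg] at harea
  have hbound := hf.weighted_area_bound hu huf hv hv0 hvu hq1
  rw [hq3, norm_mul] at hbound
  norm_num at hbound
  set x := ‖taylorCoeff f 3‖ with hx
  set y := ‖taylorCoeff f 4‖ with hy
  set s := ‖taylorCoeff f 5 - taylorCoeff f 3 ^ 2‖ with hs
  have hx0 : 0 ≤ x := norm_nonneg _
  have hy0 : 0 ≤ y := norm_nonneg _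
  have hs0 : 0 ≤ s := norm_nonneg _
  have hx1 : x ≤ 1 := by nlinarith [sq_nonneg y, sq_nonneg s]
  refine ⟨hx1, by linarith, ?_, ?_, ?_⟩
  · apply Real.le_sqrt_of_sq_le
    have h5 : ‖taylorCoeff f 5‖ ≤ s + x ^ 2 := by
      have : taylorCoeff f 5 = (taylorCoeff f 5 - taylorCoeff f 3 ^ 2) + taylorCoeff f 3 ^ 2 := by
        ring
      rw [this]
      refine (norm_add_le _ _).trans_eq ?_
      rw [norm_pow]
    -- From `x² ≤ 1 - 3s²`: the maximum of `s + 1 - 3s²` is `13/12`, at `s = 1/6`, and `(13/12)² <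
    -- 19/15`.
    have h6 : s + x ^ 2 ≤ 13 / 12 := by nlinarith [sq_nonneg (s - 1 / 6), sq_nonneg y]
    nlinarith [norm_nonneg (taylorCoeff f 5)]
  · rw [hankelTwoTwo, ha₂, zero_mul, zero_sub, norm_neg, norm_pow]
    exact pow_le_one₀ hx0 hx1
  · have : hankelThreeOne f = taylorCoeff f 3 * (taylorCoeff f 5 - taylorCoeff f 3 ^ 2) -
        taylorCoeff f 4 ^ 2 := by
      rw [hankelThreeOne, ha₂]
      ring
    rw [this]
    refine (norm_sub_le _ _).trans ?_
    rw [norm_mul, norm_pow, ← hx, ← hy, ← hs]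
    -- The area inequality gives `x s + y² ≤ 1/2 - (x - s)²/2 - s²`, well below the required bound.
    nlinarith [sq_nonneg (x - s), sq_nonneg y]
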